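/- Let $p_{-1},p_1>0$ and $p_{-1,1}\ge 0$ be real numbers with $p_{-1}+p_1+p_{-1,1}=1$. A Dyck N-walk of length $m$ is a sequence $w=(w_1,\dots,w_m)$ of N-steps $w_i\in\{\{-1\},\{1\},\{-1,1\}\}$; its probability is the product of the probabilities of its N-steps, where $\{-1\}$, $\{1\}$ and $\{-1,1\}$ have probabilities $p_{-1}$, $p_1$ and $p_{-1,1}$. The N-walk $w$ is an N-excursion if there are integers $v_i\in w_i$ ($1\le i\le m$) such that $v_1+\dots+v_j\ge 0$ for all $0\le j\le m$ and $v_1+\dots+v_m=0$. **Theorem.** Let $P_n$ be the probability that a random Dyck N-walk of length $2n$ is an N-excursion. For every $n$, $P_n$ is unchanged when $p_{-1}$ and $p_1$ are interchanged. As $n\to\infty$, with implied constants that may depend on $p_{-1}$ and $p_1$: 1. if $0<p_1\le p_{-1}<\frac12$, then $P_n=\dfrac{(1-2p_1)(1-2p_{-1})}{(1-p_1)(1-p_{-1})}+\mathcal O\!\left(\dfrac{(4p_{-1}(1-p_{-1}))^n}{n^{3/2}}\right)$; 2. if $0<p_1<\frac12$ and $p_{-1}=\frac12$, then $P_n=\dfrac{1-2p_1}{(1-p_1)\sqrt{\pi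 n}}+\mathcal O\!\left(\dfrac1{n^{3/2}}\right)$; 3. if $p_1=p_{-1}=\frac12$, then $P_n=\dfrac1{\sqrt{\pi n^3}}+\mathcal O\!\left(\dfrac1{n^{5/2}}\right)$; 4. if $0<p_1<\frac12<p_{-1}<1$ (and $p_{-1}+p_1\le 1$, which always holds here), then $P_n=\mathcal O\!\left(\dfrac{(4p_{-1}(1-p_{-1}))^n}{n^{3/2}}\right)$. By the symmetry, the same four statements hold with $p_{-1}$ and $p_1$ interchanged. -/

import Mathlib

open Filter Asymptotics

/-- The point reached after the first `j` steps of the walk `v`, started at the origin. -/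
def walkHeight {n : ℕ} (v : Fin n → ℤ) (j : ℕ) : ℤ :=
  ∑ i ∈ Finset.univ.filter (fun i : Fin n => (i : ℕ) < j), v i

/-- A meander: all points of the walk have nonnegative ordinate. -/
def IsMeander {n : ℕ} (v : Fin n → ℤ) : Prop :=
  ∀ j ≤ n, 0 ≤ walkHeight v j

/-- An excursion: a meander that ends at the origin. -/
def IsExcursion {n : ℕ} (v : Fin n → ℤ) : Prop :=
  IsMeander v ∧ walkHeight v n = 0

/-- The sequence of N-steps `w` and the walk `v` are compatible. -/
def Compatible {n : ℕ} (w : Fin n → Set ℤ) (v : Fin n → ℤ) : Prop :=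
  ∀ i, v i ∈ w i

/-- `w` is an N-excursion: it is compatible with at least one excursion. -/
def IsNExcursion {n : ℕ} (w : Fin n → Set ℤ) : Prop :=
  ∃ v : Fin n → ℤ, Compatible w v ∧ IsExcursion v

/-- The Dyck N-steps, that is, the nonempty subsets of `{-1, 1}`. -/
def dyckNSteps : Finset (Finset ℤ) :=
  {{-1}, {1}, {-1, 1}}

/-- The Dyck N-walks of length `n`. -/
def dyckNWalks (n : ℕ) : Finset (Fin n → Finset ℤ) :=
  Fintype.piFinset fun _ => dyckNSteps

/-- The weight of a Dyck N-step: `pm` for `{-1}`, `p1` for `{1}` and `pb` for `{-1, 1}`. -/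
def dyckWeight (pm p1 pb : ℝ) (s : Finset ℤ) : ℝ :=
  if s = {-1} then pm else if s = {1} then p1 else if s = {-1, 1} then pb else 0

open Classical in
/-- The probability that a Dyck N-walk of length `n` is an N-excursion, where the probability of
an N-walk is the product of the weights of its N-steps. -/
noncomputable def dyckNExcursionProb (pm p1 pb : ℝ) (n : ℕ) : ℝ :=
  ∑ w ∈ dyckNWalks n with IsNExcursion (fun i => (w i : Set ℤ)),
    ∏ i, dyckWeight pm p1 pb (w i)

/-! Replacing each N-step by its largest or smallest element gives an upper and a lower walk. At
even length, an N-walk is an N-excursion exactly when the upper walk stays nonnegative and every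
suffix of the lower walk has nonpositive sum (`reaches_zero_iff`). Necessity is clear; for
sufficiency, a path can be chosen greedily, parity removing the only ambiguity.

Each condition fails through a first passage to -1: of the upper walk, with down probability `pm`,
and of the reversed, negated lower walk, with down probability `p1`. If both fail, the second
failure takes place after the first passage of the upper walk, so the two passage series multiply.
Inclusion–exclusion then shows that `P_n` is the coefficient of z^(2n) in (1 - φ_pm)(1 - φ_p1)/(1 -
z) (`dyckNExcursionProb_eq_coeff`), which is symmetric in `pm` and `p1`.

The coefficients of φ_p are Catalan numbers times p (p(1-p))^k, at most (4p(1-p))^k (k+1)^(-3/2),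
and their sum is min(1, p/(1-p)). Separating total masses from tails gives
`dyckNExcursionProb_eq_tail`. Away from 1/2 the tails and their convolution are of the order of the
error term. At `pm = 1/2` the tail is exactly the normalized central binomial coefficient, estimated
by Wallis' product; at `pm = p1 = 1/2` the probability itself has a closed form. -/

/-! ### N-walks as lists -/

/-- The largest step allowed by a Dyck N-step. -/
def upStep (s : Finset ℤ) : ℤ := if 1 ∈ s then 1 else -1

/-- The smallest step allowed by a Dyck N-step. -/
def lowStep (s : Finset ℤ) : ℤ := if -1 ∈ s then -1 else 1

/-- The walk from height `h` that replaces each N-step `s` by `d s` stays nonnegative. -/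
def Stays (d : Finset ℤ → ℤ) : ℤ → List (Finset ℤ) → Prop
  | h, [] => 0 ≤ h
  | h, s :: l => 0 ≤ h ∧ Stays d (h + d s) l

/-- Some nonnegative walk from height `h`, compatible with the given N-steps, ends at `0`. -/
def Reaches : ℤ → List (Finset ℤ) → Prop
  | h, [] => h = 0
  | h, s :: l => 0 ≤ h ∧ ∃ x ∈ s, Reaches (h + x) l

/-- The total of the smallest allowed steps along every suffix is nonpositive. -/
def LowSuffixes (l : List (Finset ℤ)) : Prop := Stays (fun s => -lowStep s) 0 l.reverse

theorem walkHeight_zero {n : ℕ} (v : Fin n → ℤ) : walkHeight v 0 = 0 := by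
  simp [walkHeight]

theorem walkHeight_cons {n : ℕ} (x : ℤ) (v : Fin n → ℤ) (j : ℕ) :
    walkHeight (Fin.cons x v : Fin (n + 1) → ℤ) (j + 1) = x + walkHeight v j := by
  simp [walkHeight, Finset.sum_filter, Fin.sum_univ_succ]

theorem exists_compatible_iff_reaches {n : ℕ} (w : Fin n → Finset ℤ) (h : ℤ) :
    (∃ v : Fin n → ℤ, (∀ i, v i ∈ w i) ∧ (∀ j ≤ n, 0 ≤ h + walkHeight v j) ∧
      h + walkHeight v n = 0) ↔ Reaches h (List.ofFn w) := by
  induction n generalizing h with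
  | zero =>
    simp only [List.ofFn_zero, Reaches]
    constructor
    · rintro ⟨v, -, -, hv⟩
      simpa [walkHeight_zero] using hv
    · rintro rfl
      exact ⟨Fin.elim0, fun i => i.elim0, by simp [walkHeight], by simp [walkHeight]⟩
  | succ n ih =>
    rw [List.ofFn_succ]
    simp only [Reaches, ← ih]
    constructor
    · rintro ⟨v, hv, hpos, hend⟩
      obtain ⟨x, u, rfl⟩ : ∃ x u, v = (Fin.cons x u : Fin (n + 1) → ℤ) :=
        ⟨v 0, Fin.tail v, (Fin.cons_self_tail v).symm⟩
      refine ⟨by simpa [walkHeight_zero] using hpos 0 (Nat.zero_le _), x, by simpa using hv 0, u,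
        fun i => by simpa using hv i.succ, fun j hj => ?_, ?_⟩
      · have := hpos (j + 1) (by omega)
        rwa [walkHeight_cons, ← add_assoc] at this
      · rwa [walkHeight_cons, ← add_assoc] at hend
    · rintro ⟨h0, x, hx, u, hu, hpos, hend⟩
      refine ⟨(Fin.cons x u : Fin (n + 1) → ℤ), ?_, ?_, ?_⟩
      · intro i
        refine Fin.cases ?_ (fun i => ?_) i
        · simpa using hx
        · simpa using hu i
      · intro j hj
        cases j with
        | zero => simpa [walkHeight_zero] using h0
        | succ j =>
          rw [walkHeight_cons, ← add_assoc]
          exact hpos j (by omega)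
      · rw [walkHeight_cons, ← add_assoc]
        exact hend

theorem isNExcursion_iff_reaches {n : ℕ} (w : Fin n → Finset ℤ) :
    IsNExcursion (fun i => (w i : Set ℤ)) ↔ Reaches 0 (List.ofFn w) := by
  rw [← exists_compatible_iff_reaches]
  simp [IsNExcursion, IsExcursion, IsMeander, Compatible]

theorem Stays.nonneg {d : Finset ℤ → ℤ} {h : ℤ} {l : List (Finset ℤ)} (hl : Stays d h l) :
    0 ≤ h := by
  cases l with
  | nil => exact hl
  | cons s l => exact hl.1

theorem stays_concat (d : Finset ℤ → ℤ) (h : ℤ) (l : List (Finset ℤ)) (s : Finset ℤ) :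
    Stays d h (l ++ [s]) ↔ Stays d h l ∧ 0 ≤ h + (l.map d).sum + d s := by
  induction l generalizing h with
  | nil => simp [Stays]
  | cons t l ih => simp [Stays, ih, and_assoc, add_assoc]

theorem lowSuffixes_cons (s : Finset ℤ) (l : List (Finset ℤ)) :
    LowSuffixes (s :: l) ↔ LowSuffixes l ∧ lowStep s + (l.map lowStep).sum ≤ 0 := by
  have : (l.map fun s => -lowStep s).sum = -(l.map lowStep).sum := by
    induction l with
    | nil => simp
    | cons t l ih => simp [ih, add_comm]
  rw [LowSuffixes, List.reverse_cons, stays_concat, ← LowSuffixes, List.map_reverse,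
    List.sum_reverse, this]
  constructor <;> rintro ⟨h1, h2⟩ <;> exact ⟨h1, by linarith⟩

theorem LowSuffixes.sum_nonpos {l : List (Finset ℤ)} (hl : LowSuffixes l) :
    (l.map lowStep).sum ≤ 0 := by
  cases l with
  | nil => simp
  | cons s l => simpa using ((lowSuffixes_cons s l).1 hl).2

theorem lowStep_le_upStep {s : Finset ℤ} (hs : s ∈ dyckNSteps) : lowStep s ≤ upStep s := by
  revert s
  decide

/-- Suffix sums of the lower walk are nonpositive and its endpoint is nonnegative, so every earlier
height is nonnegative too. The upper walk dominates it. -/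
theorem LowSuffixes.stays_upStep {l : List (Finset ℤ)} (hd : ∀ s ∈ l, s ∈ dyckNSteps)
    (hl : LowSuffixes l) {h : ℤ} (hh : 0 ≤ h + (l.map lowStep).sum) : Stays upStep h l := by
  induction l generalizing h with
  | nil => simpa [Stays] using hh
  | cons s l ih =>
    have h1 := hl.sum_nonpos
    have h2 := lowStep_le_upStep (hd s (by simp))
    refine ⟨by linarith, ih (fun t ht => hd t (by simp [ht])) ((lowSuffixes_cons s l).1 hl).1 ?_⟩
    simp only [List.map_cons, List.sum_cons] at hh
    linarith

theorem Stays.mono {d : Finset ℤ → ℤ} {h k : ℤ} (hk : h ≤ k) {l : List (Finset ℤ)}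
    (hl : Stays d h l) : Stays d k l := by
  induction l generalizing h k with
  | nil => exact le_trans hl hk
  | cons s l ih => exact ⟨hl.1.trans hk, ih (by linarith) hl.2⟩

theorem even_sum_lowStep_add_length (l : List (Finset ℤ)) :
    Even ((l.map lowStep).sum + l.length) := by
  induction l with
  | nil => simp
  | cons s l ih =>
    simp only [List.map_cons, List.sum_cons, List.length_cons, Nat.cast_add, Nat.cast_one]
    have : Even (lowStep s + 1) := by
      unfold lowStep
      split_ifs <;> decide
    obtain ⟨x, hx⟩ := ih
    obtain ⟨y, hy⟩ := this
    exact ⟨x + y, by omega⟩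

/-- Induction on the first N-step; only `{-1, 1}` leaves a choice. Going up is safe for the upper
walk, and is right unless the lower walk would then end above 0. -/
theorem reaches_iff {l : List (Finset ℤ)} (hd : ∀ s ∈ l, s ∈ dyckNSteps) {h : ℤ}
    (hpar : Even (h + l.length)) :
    Reaches h l ↔ Stays upStep h l ∧ h + (l.map lowStep).sum ≤ 0 ∧ LowSuffixes l := by
  induction l generalizing h with
  | nil =>
    simp [Reaches, Stays, LowSuffixes]
    omega
  | cons s l ih =>
    have hd' : ∀ t ∈ l, t ∈ dyckNSteps := fun t ht => hd t (by simp [ht])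
    simp only [List.length_cons, Nat.cast_add, Nat.cast_one] at hpar
    have hup := ih hd' (h := h + 1) (by
      obtain ⟨x, hx⟩ := hpar
      exact ⟨x, by omega⟩)
    have hdown := ih hd' (h := h + -1) (by
      obtain ⟨x, hx⟩ := hpar
      exact ⟨x - 1, by omega⟩)
    have hs := hd s (by simp)
    simp only [Reaches, Stays, lowSuffixes_cons, List.map_cons, List.sum_cons]
    simp only [dyckNSteps, Finset.mem_insert, Finset.mem_singleton] at hs
    rcases hs with rfl | rfl | rfl
    · have h1 : upStep {-1} = -1 := by decide
      have h2 : lowStep {-1} = -1 := by decide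
      simp only [Finset.mem_singleton, exists_eq_left, hdown, h1, h2]
      constructor
      · rintro ⟨a, b, c, e⟩
        exact ⟨⟨a, b⟩, by linarith, e, by linarith⟩
      · rintro ⟨⟨a, b⟩, c, e, f⟩
        exact ⟨a, b, by linarith, e⟩
    · have h1 : upStep {1} = 1 := by decide
      have h2 : lowStep {1} = 1 := by decide
      simp only [Finset.mem_singleton, exists_eq_left, hup, h1, h2]
      constructor
      · rintro ⟨a, b, c, e⟩
        exact ⟨⟨a, b⟩, by linarith, e, by linarith⟩
      · rintro ⟨⟨a, b⟩, c, e, f⟩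
        exact ⟨a, b, by linarith, e⟩
    · have h1 : upStep {-1, 1} = 1 := by decide
      have h2 : lowStep {-1, 1} = -1 := by decide
      simp only [Finset.mem_insert, Finset.mem_singleton, exists_eq_or_imp, exists_eq_left, hup,
        hdown, h1, h2]
      constructor
      · rintro ⟨a, ⟨b, c, e⟩ | ⟨b, c, e⟩⟩
        · exact ⟨⟨a, b.mono (by linarith)⟩, by linarith, e, by linarith⟩
        · exact ⟨⟨a, b⟩, by linarith, e, by linarith⟩
      · rintro ⟨⟨a, b⟩, c, e, f⟩
        refine ⟨a, ?_⟩
        by_cases hle : h + 1 + (l.map lowStep).sum ≤ 0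
        · exact Or.inr ⟨b, hle, e⟩
        -- The lower walk ends at -1 or 0 after a down step, and parity excludes -1. Its nonpositive
        -- suffixes then keep the upper walk nonnegative as well.
        · have hzero : h + -1 + (l.map lowStep).sum = 0 := by
            obtain ⟨x, hx⟩ := hpar
            obtain ⟨y, hy⟩ := even_sum_lowStep_add_length l
            omega
          exact Or.inl ⟨e.stays_upStep hd' hzero.ge, hzero.le, e⟩

theorem reaches_zero_iff {l : List (Finset ℤ)} (hd : ∀ s ∈ l, s ∈ dyckNSteps)
    (hpar : Even l.length) : Reaches 0 l ↔ Stays upStep 0 l ∧ LowSuffixes l := by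
  rw [reaches_iff hd (by simpa using hpar)]
  exact ⟨fun h => ⟨h.1, h.2.2⟩, fun h => ⟨h.1, by simpa using h.2.sum_nonpos, h.2⟩⟩

/-! ### Weighted sums over N-walks -/

/-- The sum of `f`, weighted by the product of the weights of the steps, over all Dyck N-walks of
length `m`. -/
def walkSum (wt : Finset ℤ → ℝ) : ℕ → (List (Finset ℤ) → ℝ) → ℝ
  | 0, f => f []
  | m + 1, f => ∑ s ∈ dyckNSteps, wt s * walkSum wt m fun l => f (s :: l)

theorem sum_dyckNWalks (wt : Finset ℤ → ℝ) (m : ℕ) (f : List (Finset ℤ) → ℝ) :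
    ∑ w ∈ dyckNWalks m, (∏ i, wt (w i)) * f (List.ofFn w) = walkSum wt m f := by
  induction m generalizing f with
  | zero => simp [dyckNWalks, walkSum]
  | succ m ih =>
    simp only [walkSum, ← ih, Finset.mul_sum]
    rw [← Finset.sum_product']
    refine Finset.sum_nbij' (fun w => (w 0, Fin.tail w)) (fun x => Fin.cons x.1 x.2) ?_ ?_ ?_ ?_ ?_
    · intro w hw
      simp only [dyckNWalks, Fintype.mem_piFinset, Finset.mem_product] at hw ⊢
      exact ⟨hw 0, fun i => hw i.succ⟩
    · rintro ⟨s, w⟩ hw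
      simp only [dyckNWalks, Fintype.mem_piFinset, Finset.mem_product] at hw ⊢
      intro i
      refine Fin.cases ?_ (fun i => ?_) i
      · simpa using hw.1
      · simpa using hw.2 i
    · intro w _
      simp
    · rintro ⟨s, w⟩ _
      simp
    · intro w _
      simp only [Fin.prod_univ_succ, List.ofFn_succ, mul_assoc]
      rfl

theorem walkSum_congr {wt : Finset ℤ → ℝ} {m : ℕ} {f g : List (Finset ℤ) → ℝ}
    (h : ∀ l : List (Finset ℤ), l.length = m → (∀ s ∈ l, s ∈ dyckNSteps) → f l = g l) :
    walkSum wt m f = walkSum wt m g := by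
  induction m generalizing f g with
  | zero => exact h [] rfl (by simp)
  | succ m ih =>
    refine Finset.sum_congr rfl fun s hs => ?_
    rw [ih fun l hl hd => h (s :: l) (by simp [hl]) (by simpa [hs] using hd)]

theorem walkSum_add (wt : Finset ℤ → ℝ) (m : ℕ) (f g : List (Finset ℤ) → ℝ) :
    walkSum wt m (fun l => f l + g l) = walkSum wt m f + walkSum wt m g := by
  induction m generalizing f g with
  | zero => rfl
  | succ m ih => simp only [walkSum, ih, mul_add, Finset.sum_add_distrib]

theorem walkSum_sub (wt : Finset ℤ → ℝ) (m : ℕ) (f g : List (Finset ℤ) → ℝ) :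
    walkSum wt m (fun l => f l - g l) = walkSum wt m f - walkSum wt m g := by
  rw [eq_sub_iff_add_eq, ← walkSum_add]
  simp

theorem walkSum_one {wt : Finset ℤ → ℝ} (hwt : ∑ s ∈ dyckNSteps, wt s = 1) (m : ℕ) :
    walkSum wt m (fun _ => 1) = 1 := by
  induction m with
  | zero => rfl
  | succ m ih => simp only [walkSum, ih, mul_one, hwt]

theorem walkSum_succ_concat (wt : Finset ℤ → ℝ) (m : ℕ) (f : List (Finset ℤ) → ℝ) :
    walkSum wt (m + 1) f = ∑ s ∈ dyckNSteps, wt s * walkSum wt m fun l => f (l ++ [s]) := by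
  induction m generalizing f with
  | zero => rfl
  | succ m ih =>
    rw [walkSum]
    conv_lhs => simp only [ih]
    simp only [walkSum, Finset.mul_sum, List.cons_append]
    rw [Finset.sum_comm]
    exact Finset.sum_congr rfl fun s _ => Finset.sum_congr rfl fun t _ => by ring

/-- The steps are independent and identically distributed, so reversal preserves the measure. This
turns conditions on suffixes into first-passage conditions. -/
theorem walkSum_reverse (wt : Finset ℤ → ℝ) (m : ℕ) (f : List (Finset ℤ) → ℝ) :
    walkSum wt m (fun l => f l.reverse) = walkSum wt m f := by
  induction m generalizing f with
  | zero => rfl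
  | succ m ih =>
    rw [walkSum_succ_concat wt m f, walkSum]
    simp only [List.reverse_cons]
    exact Finset.sum_congr rfl fun s _ => by rw [ih fun l => f (l ++ [s])]

theorem sum_dyckNSteps (f : Finset ℤ → ℝ) :
    ∑ s ∈ dyckNSteps, f s = f {-1} + f {1} + f {-1, 1} := by
  rw [dyckNSteps, Finset.sum_insert (by decide), Finset.sum_insert (by decide),
    Finset.sum_singleton, add_assoc]

/-! ### First passage -/

open PowerSeries in
-- Descending `h` levels takes `h` independent one-level passages, whence `φ ^ h`. The row `R 0` is
-- left free: it records what is asked of the walk once the passage is over.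
theorem coeff_of_first_passage_recurrence {p q : ℝ} {φ : PowerSeries ℝ}
    (hφ : φ = X * (C p + C q * φ ^ 2)) {R : ℕ → ℕ → ℝ} (hzero : ∀ h, R (h + 1) 0 = 0)
    (hsucc : ∀ h m, R (h + 1) (m + 1) = p * R h m + q * R (h + 2) m) (h m : ℕ) :
    R h m = coeff m (φ ^ h * PowerSeries.mk (R 0)) := by
  induction m generalizing h with
  | zero =>
    cases h with
    | zero => simp
    | succ h =>
      have : constantCoeff φ = 0 := by rw [hφ]; simp
      simp [hzero, this]
  | succ m ih =>
    cases h with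
    | zero => simp
    | succ h =>
      have : φ ^ (h + 1) * PowerSeries.mk (R 0) = X * (C p * (φ ^ h * PowerSeries.mk (R 0)) +
          C q * (φ ^ (h + 2) * PowerSeries.mk (R 0))) := by
        rw [pow_succ]
        nth_rewrite 2 [hφ]
        ring
      rw [this, coeff_succ_X_mul, map_add, coeff_C_mul, coeff_C_mul, ← ih, ← ih, hsucc]

open PowerSeries in
/-- The generating function of the time at which a simple walk with probability `p` of a down
step first goes below its starting point. -/
noncomputable def passageSeries (p : ℝ) : PowerSeries ℝ :=
  C p * X * expand 2 two_ne_zero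
    (rescale (p * (1 - p)) (PowerSeries.map (Nat.castRingHom ℝ) catalanSeries))

open PowerSeries in
-- This is the Catalan equation C = 1 + X C², rescaled by p(1-p) and evaluated at X².
theorem passageSeries_eq (p : ℝ) :
    passageSeries p = X * (C p + C (1 - p) * passageSeries p ^ 2) := by
  have h := congrArg (fun f => expand 2 two_ne_zero
    (rescale (p * (1 - p)) (PowerSeries.map (Nat.castRingHom ℝ) f))) catalanSeries_sq_mul_X_add_one
  simp only [map_add, map_mul, map_pow, PowerSeries.map_X, map_one, rescale_X, expand_X,
    expand_C] at h
  rw [passageSeries]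
  nth_rewrite 1 [← h]
  ring

open PowerSeries in
theorem coeff_passageSeries_even (p : ℝ) (k : ℕ) : coeff (2 * k) (passageSeries p) = 0 := by
  rw [passageSeries, mul_assoc, coeff_C_mul]
  cases k with
  | zero => simp
  | succ k =>
    rw [show 2 * (k + 1) = 2 * k + 1 + 1 by ring, coeff_succ_X_mul,
      coeff_expand_of_not_dvd _ _ _ (by omega), mul_zero]

open PowerSeries in
theorem coeff_passageSeries_odd (p : ℝ) (k : ℕ) :
    coeff (2 * k + 1) (passageSeries p) = p * ((p * (1 - p)) ^ k * catalan k) := by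
  rw [passageSeries, mul_assoc, coeff_C_mul, coeff_succ_X_mul, coeff_expand_mul, coeff_rescale]
  simp

/-! ### Inclusion–exclusion over the two obstructions -/

open Classical in
/-- The real number `1` or `0` according to the truth of a proposition. -/
noncomputable def truth (P : Prop) : ℝ := if P then 1 else 0

theorem truth_of {P : Prop} (h : P) : truth P = 1 := if_pos h

theorem truth_of_not {P : Prop} (h : ¬P) : truth P = 0 := if_neg h

theorem truth_congr {P Q : Prop} (h : P ↔ Q) : truth P = truth Q := by rw [propext h]

theorem truth_and_eq (P Q : Prop) :
    truth (P ∧ Q) = 1 - truth (¬P) - truth (¬Q) + truth (¬P ∧ ¬Q) := by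
  by_cases hP : P <;> by_cases hQ : Q <;> simp [truth, hP, hQ]

theorem not_stays_neg_one (d : Finset ℤ → ℤ) (l : List (Finset ℤ)) : ¬Stays d (-1) l :=
  fun h => absurd h.nonneg (by norm_num)

theorem dyckWeight_down (pm p1 pb : ℝ) : dyckWeight pm p1 pb {-1} = pm := by
  simp [dyckWeight]

theorem dyckWeight_up (pm p1 pb : ℝ) : dyckWeight pm p1 pb {1} = p1 := by
  rw [dyckWeight, if_neg (by decide), if_pos rfl]

theorem dyckWeight_both (pm p1 pb : ℝ) : dyckWeight pm p1 pb {-1, 1} = pb := by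
  rw [dyckWeight, if_neg (by decide), if_neg (by decide), if_pos rfl]

theorem sum_dyckWeight_mul (pm p1 pb : ℝ) (f : Finset ℤ → ℝ) :
    ∑ s ∈ dyckNSteps, dyckWeight pm p1 pb s * f s = pm * f {-1} + p1 * f {1} + pb * f {-1, 1} := by
  rw [sum_dyckNSteps, dyckWeight_down, dyckWeight_up, dyckWeight_both]

theorem walkSum_dyckWeight_one {pm p1 pb : ℝ} (hsum : pm + p1 + pb = 1) (m : ℕ) :
    walkSum (dyckWeight pm p1 pb) m (fun _ => 1) = 1 :=
  walkSum_one (by simpa [hsum] using sum_dyckWeight_mul pm p1 pb fun _ => 1) m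

/-- The probability that the upper walk becomes negative. -/
theorem walkSum_not_stays_upStep {pm p1 pb : ℝ} (hsum : pm + p1 + pb = 1) (m : ℕ) :
    walkSum (dyckWeight pm p1 pb) m (fun l => truth (¬Stays upStep 0 l)) =
      PowerSeries.coeff m (passageSeries pm * PowerSeries.mk fun _ => 1) := by
  -- The index `h` counts the levels still to descend, so the height is `h - 1`; at `h = 0` the
  -- passage has occurred.
  have key := coeff_of_first_passage_recurrence (passageSeries_eq pm)
    (R := fun h m => walkSum (dyckWeight pm p1 pb) m fun l => truth (¬Stays upStep (h - 1) l))
    (fun h => by simp [walkSum, Stays, truth]) (fun h m => ?_) 1 m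
  · simpa [not_stays_neg_one, truth, walkSum_dyckWeight_one hsum] using key
  · have h1 : upStep {-1} = -1 := by decide
    have h2 : upStep {1} = 1 := by decide
    have h3 : upStep {-1, 1} = 1 := by decide
    have hq : (1 - pm) = p1 + pb := by linarith
    have h0 : (0 : ℤ) ≤ h := by positivity
    simp only [walkSum, sum_dyckWeight_mul, Stays, h1, h2, h3, hq]
    push_cast
    simp only [add_sub_cancel_right, h0, true_and, ← sub_eq_add_neg,
      show (h : ℤ) + 2 - 1 = h + 1 by ring]
    ring

/-- The probability that the lower walk goes up along some suffix. -/
theorem walkSum_not_lowSuffixes {pm p1 pb : ℝ} (hsum : pm + p1 + pb = 1) (m : ℕ) :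
    walkSum (dyckWeight pm p1 pb) m (fun l => truth (¬LowSuffixes l)) =
      PowerSeries.coeff m (passageSeries p1 * PowerSeries.mk fun _ => 1) := by
  simp only [LowSuffixes]
  rw [walkSum_reverse _ _ fun l => truth (¬Stays (fun s => -lowStep s) 0 l)]
  have key := coeff_of_first_passage_recurrence (passageSeries_eq p1)
    (R := fun h m => walkSum (dyckWeight pm p1 pb) m fun l =>
      truth (¬Stays (fun s => -lowStep s) (h - 1) l))
    (fun h => by simp [walkSum, Stays, truth]) (fun h m => ?_) 1 m
  · simpa [not_stays_neg_one, truth, walkSum_dyckWeight_one hsum] using key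
  · have h1 : -lowStep {-1} = 1 := by decide
    have h2 : -lowStep {1} = -1 := by decide
    have h3 : -lowStep {-1, 1} = 1 := by decide
    have hq : (1 - p1) = pm + pb := by linarith
    have h0 : (0 : ℤ) ≤ h := by positivity
    simp only [walkSum, sum_dyckWeight_mul, Stays, h1, h2, h3, hq]
    push_cast
    simp only [add_sub_cancel_right, h0, true_and, ← sub_eq_add_neg,
      show (h : ℤ) + 2 - 1 = h + 1 by ring]
    ring

/-- If the violating suffix of the lower walk were only the whole list, `LowSuffixes.stays_upStep`
would keep the upper walk nonnegative. So the first step can be dropped from both conditions. -/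
theorem not_stays_and_not_lowSuffixes_cons {h : ℤ} (hh : 0 ≤ h) {s : Finset ℤ}
    {l : List (Finset ℤ)} (hd : ∀ t ∈ s :: l, t ∈ dyckNSteps) :
    ¬Stays upStep h (s :: l) ∧ ¬LowSuffixes (s :: l) ↔
      ¬Stays upStep (h + upStep s) l ∧ ¬LowSuffixes l := by
  simp only [Stays, hh, true_and, lowSuffixes_cons, and_congr_right_iff, not_iff_not,
    and_iff_left_iff_imp]
  intro hs hl
  by_contra! hpos
  have := lowStep_le_upStep (hd s (by simp))
  exact hs (hl.stays_upStep (fun t ht => hd t (by simp [ht])) (by linarith))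

/-- The probability of both obstructions to being an N-excursion: the first passage of the upper
walk happens before the last suffix along which the lower walk goes up. -/
theorem walkSum_not_stays_upStep_and_not_lowSuffixes {pm p1 pb : ℝ} (hsum : pm + p1 + pb = 1)
    (m : ℕ) :
    walkSum (dyckWeight pm p1 pb) m (fun l => truth (¬Stays upStep 0 l ∧ ¬LowSuffixes l)) =
      PowerSeries.coeff m (passageSeries pm * (passageSeries p1 * PowerSeries.mk fun _ => 1)) := by
  have key := coeff_of_first_passage_recurrence (passageSeries_eq pm)
    (R := fun h m => walkSum (dyckWeight pm p1 pb) m fun l =>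
      truth (¬Stays upStep (h - 1) l ∧ ¬LowSuffixes l))
    (fun h => by simp [walkSum, Stays, truth]) (fun h m => ?_) 1 m
  -- Here the row `R 0` is the probability that the steps left after the passage violate the suffix
  -- condition.
  · have hB : (PowerSeries.mk fun m => walkSum (dyckWeight pm p1 pb) m fun l =>
        truth (¬LowSuffixes l)) = passageSeries p1 * PowerSeries.mk fun _ => 1 := by
      ext m
      rw [PowerSeries.coeff_mk, walkSum_not_lowSuffixes hsum]
    simpa [not_stays_neg_one, hB] using key
  · have h1 : upStep {-1} = -1 := by decide
    have h2 : upStep {1} = 1 := by decide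
    have h3 : upStep {-1, 1} = 1 := by decide
    have hq : (1 - pm) = p1 + pb := by linarith
    have h0 : (0 : ℤ) ≤ h := by positivity
    have hstep : ∀ s ∈ dyckNSteps,
        (walkSum (dyckWeight pm p1 pb) m fun l =>
          truth (¬Stays upStep (h + 1 - 1) (s :: l) ∧ ¬LowSuffixes (s :: l))) =
        walkSum (dyckWeight pm p1 pb) m fun l =>
          truth (¬Stays upStep (h + upStep s) l ∧ ¬LowSuffixes l) := fun s hs =>
      walkSum_congr fun l _ hd => truth_congr (by
        rw [add_sub_cancel_right]
        exact not_stays_and_not_lowSuffixes_cons h0 (by simpa [hs] using hd))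
    simp only [walkSum, sum_dyckWeight_mul, hq]
    push_cast
    rw [hstep _ (by decide), hstep _ (by decide), hstep _ (by decide), h1, h2, h3]
    simp only [← sub_eq_add_neg, show (h : ℤ) + 2 - 1 = h + 1 by ring]
    ring

/-! ### Exact formulas for the N-excursion probability -/

theorem dyckNExcursionProb_eq_coeff {pm p1 pb : ℝ} (hsum : pm + p1 + pb = 1) (n : ℕ) :
    dyckNExcursionProb pm p1 pb (2 * n) =
      PowerSeries.coeff (2 * n)
        ((1 - passageSeries pm) * (1 - passageSeries p1) * PowerSeries.mk fun _ => 1) := by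
  have h1 : dyckNExcursionProb pm p1 pb (2 * n) =
      walkSum (dyckWeight pm p1 pb) (2 * n) fun l => truth (Reaches 0 l) := by
    rw [← sum_dyckNWalks, dyckNExcursionProb, Finset.sum_filter]
    refine Finset.sum_congr rfl fun w _ => ?_
    by_cases h : Reaches 0 (List.ofFn w)
    · rw [if_pos ((isNExcursion_iff_reaches w).2 h), truth_of h, mul_one]
    · rw [if_neg fun hw => h ((isNExcursion_iff_reaches w).1 hw), truth_of_not h, mul_zero]
  have h2 : (walkSum (dyckWeight pm p1 pb) (2 * n) fun l => truth (Reaches 0 l)) =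
      walkSum (dyckWeight pm p1 pb) (2 * n) fun l =>
        1 - truth (¬Stays upStep 0 l) - truth (¬LowSuffixes l) +
          truth (¬Stays upStep 0 l ∧ ¬LowSuffixes l) :=
    walkSum_congr fun l hl hd => by
      rw [← truth_and_eq]
      exact truth_congr (reaches_zero_iff hd (by rw [hl]; exact even_two_mul n))
  have h3 : (1 - passageSeries pm) * (1 - passageSeries p1) * (PowerSeries.mk fun _ => 1) =
      (PowerSeries.mk fun _ => 1) - passageSeries pm * (PowerSeries.mk fun _ => 1)
        - passageSeries p1 * (PowerSeries.mk fun _ => 1)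
        + passageSeries pm * (passageSeries p1 * PowerSeries.mk fun _ => 1) := by ring
  rw [h1, h2, walkSum_add, walkSum_sub, walkSum_sub, walkSum_dyckWeight_one hsum,
    walkSum_not_stays_upStep hsum, walkSum_not_lowSuffixes hsum,
    walkSum_not_stays_upStep_and_not_lowSuffixes hsum, h3]
  simp

theorem dyckNExcursionProb_comm {pm p1 pb : ℝ} (hsum : pm + p1 + pb = 1) (n : ℕ) :
    dyckNExcursionProb pm p1 pb (2 * n) = dyckNExcursionProb p1 pm pb (2 * n) := by
  rw [dyckNExcursionProb_eq_coeff hsum, dyckNExcursionProb_eq_coeff (by linarith),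
    mul_comm (1 - passageSeries pm)]

/-- The probability that a simple walk with probability `p` of a down step first goes below its
starting point at time `2 * k + 1`. -/
noncomputable def passageProb (p : ℝ) (k : ℕ) : ℝ := p * ((p * (1 - p)) ^ k * catalan k)

theorem sum_range_two_mul_coeff_passageSeries_mul (p : ℝ) (g : ℕ → ℝ) (n : ℕ) :
    ∑ k ∈ Finset.range (2 * n), PowerSeries.coeff k (passageSeries p) * g k =
      ∑ k ∈ Finset.range n, passageProb p k * g (2 * k + 1) := by
  induction n with
  | zero => simp
  | succ n ih =>
    rw [show 2 * (n + 1) = 2 * n + 1 + 1 by ring, Finset.sum_range_succ, Finset.sum_range_succ, ih,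
      Finset.sum_range_succ, coeff_passageSeries_even, coeff_passageSeries_odd, passageProb]
    ring

theorem sum_range_two_mul_succ_coeff_passageSeries_mul (p : ℝ) (g : ℕ → ℝ) (n : ℕ) :
    ∑ k ∈ Finset.range (2 * n + 1), PowerSeries.coeff k (passageSeries p) * g k =
      ∑ k ∈ Finset.range n, passageProb p k * g (2 * k + 1) := by
  rw [Finset.sum_range_succ, sum_range_two_mul_coeff_passageSeries_mul, coeff_passageSeries_even,
    zero_mul, add_zero]

theorem coeff_mul_mk_one (φ : PowerSeries ℝ) (m : ℕ) :
    PowerSeries.coeff m (φ * PowerSeries.mk fun _ => 1) =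
      ∑ k ∈ Finset.range (m + 1), PowerSeries.coeff k φ := by
  rw [PowerSeries.coeff_mul, Finset.Nat.sum_antidiagonal_eq_sum_range_succ_mk]
  simp

theorem coeff_passageSeries_mul_mk_one_even (p : ℝ) (n : ℕ) :
    PowerSeries.coeff (2 * n) (passageSeries p * PowerSeries.mk fun _ => 1) =
      ∑ k ∈ Finset.range n, passageProb p k := by
  simpa [coeff_mul_mk_one] using sum_range_two_mul_succ_coeff_passageSeries_mul p (fun _ => 1) n

theorem coeff_passageSeries_mul_mk_one_odd (p : ℝ) (n : ℕ) :
    PowerSeries.coeff (2 * n + 1) (passageSeries p * PowerSeries.mk fun _ => 1) =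
      ∑ k ∈ Finset.range (n + 1), passageProb p k := by
  simpa [coeff_mul_mk_one, mul_add] using
    sum_range_two_mul_coeff_passageSeries_mul p (fun _ => 1) (n + 1)

theorem dyckNExcursionProb_eq {pm p1 pb : ℝ} (hsum : pm + p1 + pb = 1) (n : ℕ) :
    dyckNExcursionProb pm p1 pb (2 * n) =
      1 - ∑ k ∈ Finset.range n, passageProb pm k - ∑ k ∈ Finset.range n, passageProb p1 k +
        ∑ j ∈ Finset.range n,
          passageProb p1 j * ∑ k ∈ Finset.range (n - j), passageProb pm k := by
  have h3 : (1 - passageSeries pm) * (1 - passageSeries p1) * (PowerSeries.mk fun _ => 1) =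
      (PowerSeries.mk fun _ => 1) - passageSeries pm * (PowerSeries.mk fun _ => 1)
        - passageSeries p1 * (PowerSeries.mk fun _ => 1)
        + passageSeries p1 * (passageSeries pm * PowerSeries.mk fun _ => 1) := by ring
  rw [dyckNExcursionProb_eq_coeff hsum, h3, map_add, map_sub, map_sub,
    coeff_passageSeries_mul_mk_one_even, coeff_passageSeries_mul_mk_one_even,
    PowerSeries.coeff_mul (2 * n) (passageSeries p1),
    Finset.Nat.sum_antidiagonal_eq_sum_range_succ_mk,
    sum_range_two_mul_succ_coeff_passageSeries_mul p1 fun k =>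
      PowerSeries.coeff (2 * n - k) (passageSeries pm * PowerSeries.mk fun _ => 1),
    PowerSeries.coeff_mk]
  congr 1
  refine Finset.sum_congr rfl fun j hj => ?_
  have hj' := Finset.mem_range.1 hj
  -- After a passage at time 2j+1, the remaining 2(n-j)-1 steps contain n-j odd times.
  rw [show 2 * n - (2 * j + 1) = 2 * (n - j - 1) + 1 by omega, coeff_passageSeries_mul_mk_one_odd,
    show n - j - 1 + 1 = n - j by omega]

/-! ### The normalized central binomial coefficient -/

/-- The probability that a simple symmetric walk of length `2 * n` ends at its starting point. -/
noncomputable def returnProb (n : ℕ) : ℝ := n.centralBinom / 4 ^ n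

theorem returnProb_pos (n : ℕ) : 0 < returnProb n := by
  have := n.centralBinom_pos
  unfold returnProb
  positivity

theorem returnProb_succ (n : ℕ) :
    returnProb (n + 1) = returnProb n * ((2 * n + 1) / (2 * n + 2)) := by
  have h : ((n : ℝ) + 1) * (n + 1).centralBinom = 2 * (2 * n + 1) * n.centralBinom := by
    exact_mod_cast n.succ_mul_centralBinom_succ
  have h2 : ((n + 1).centralBinom : ℝ) = 2 * (2 * n + 1) * n.centralBinom / (n + 1) := by
    field_simp
    linarith
  rw [returnProb, returnProb, h2, pow_succ]
  field_simp
  ring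

theorem catalan_div_four_pow (n : ℕ) : (catalan n : ℝ) / 4 ^ n = returnProb n / (n + 1) := by
  have h : ((n : ℝ) + 1) * catalan n = n.centralBinom := by
    exact_mod_cast succ_mul_catalan_eq_centralBinom n
  rw [returnProb, ← h]
  field_simp

theorem returnProb_sq_mul_le (n : ℕ) : returnProb n ^ 2 * (n + 1) ≤ 1 := by
  induction n with
  | zero => simp [returnProb]
  | succ n ih =>
    have : ((2 * n + 1 : ℝ) / (2 * n + 2)) ^ 2 * (n + 2) ≤ n + 1 := by
      rw [div_pow, div_mul_eq_mul_div, div_le_iff₀ (by positivity)]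
      nlinarith [(Nat.cast_nonneg n : (0 : ℝ) ≤ n)]
    rw [returnProb_succ]
    push_cast
    nlinarith [sq_nonneg (returnProb n)]

theorem returnProb_le_one (n : ℕ) : returnProb n ≤ 1 := by
  have := returnProb_sq_mul_le n
  nlinarith [returnProb_pos n, mul_nonneg (sq_nonneg (returnProb n)) (Nat.cast_nonneg (α := ℝ) n)]

/-- The factorials of Wallis' partial product cancel exactly, so two-sided bounds on `W n` become
bounds on `returnProb n`. -/
theorem returnProb_sq_eq (n : ℕ) :
    returnProb n ^ 2 * (2 * n + 1) * Real.Wallis.W n = 1 := by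
  rw [Real.Wallis.W_eq_factorial_ratio, returnProb, Nat.centralBinom_eq_two_mul_choose,
    Nat.choose_eq_factorial_div_factorial (by omega), show 2 * n - n = n by omega,
    Nat.cast_div (by simpa [two_mul] using Nat.factorial_mul_factorial_dvd_factorial_add n n)
      (by positivity)]
  have h1 : (n.factorial : ℝ) ≠ 0 := by positivity
  have h2 : ((2 * n).factorial : ℝ) ≠ 0 := by positivity
  have h3 : (4 : ℝ) ^ n = 2 ^ (2 * n) := by rw [pow_mul]; norm_num
  have h4 : (2 : ℝ) ^ (4 * n) = 2 ^ (2 * n) * 2 ^ (2 * n) := by rw [← pow_add]; congr 1; ring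
  rw [h3, h4]
  push_cast
  field_simp

theorem le_returnProb_sq (n : ℕ) : 2 / (Real.pi * (2 * n + 1)) ≤ returnProb n ^ 2 := by
  have h := returnProb_sq_eq n
  have hW := Real.Wallis.W_le n
  rw [div_le_iff₀ (by positivity)]
  have : 0 ≤ returnProb n ^ 2 * (2 * n + 1) := by positivity
  nlinarith [mul_le_mul_of_nonneg_left hW this]

theorem returnProb_sq_le {n : ℕ} (hn : 0 < n) : returnProb n ^ 2 ≤ 1 / (Real.pi * n) := by
  have h := returnProb_sq_eq n
  have hW := Real.Wallis.le_W n
  have hn' : (0 : ℝ) < n := by exact_mod_cast hn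
  have hpi := Real.pi_pos
  rw [le_div_iff₀ (by positivity)]
  have h1 : Real.pi * n ≤ (2 * n + 1) * Real.Wallis.W n := by
    refine le_trans ?_ (mul_le_mul_of_nonneg_left hW (by positivity))
    rw [show (2 * (n : ℝ) + 1) * ((2 * n + 1) / (2 * n + 2) * (Real.pi / 2)) =
      Real.pi * ((2 * n + 1) ^ 2 / (4 * (n + 1))) by field_simp; ring]
    refine mul_le_mul_of_nonneg_left ?_ hpi.le
    rw [le_div_iff₀ (by positivity)]
    nlinarith
  calc returnProb n ^ 2 * (Real.pi * n) ≤
      returnProb n ^ 2 * ((2 * n + 1) * Real.Wallis.W n) := by gcongr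
    _ = 1 := by rw [← mul_assoc, h]

theorem abs_returnProb_sub_le {n : ℕ} (hn : 0 < n) :
    |returnProb n - 1 / √(Real.pi * n)| ≤ (n : ℝ) ^ (-(3 / 2) : ℝ) := by
  have hn' : (0 : ℝ) < n := by exact_mod_cast hn
  have hpi := Real.pi_pos
  have hs : 0 < √(Real.pi * n) := by positivity
  have hsq : √(Real.pi * n) ^ 2 = Real.pi * n := Real.sq_sqrt (by positivity)
  have hup : returnProb n ≤ 1 / √(Real.pi * n) := by
    rw [← pow_le_pow_iff_left₀ (returnProb_pos n).le (by positivity) two_ne_zero, div_pow, hsq,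
      one_pow]
    exact returnProb_sq_le hn
  -- Wallis gives the factor √t with t = 2n/(2n+1); since t ≤ 1, the weaker factor t avoids the root
  -- and leaves relative error 1/(2n+1).
  have hlow : 1 / √(Real.pi * n) * (2 * n / (2 * n + 1)) ≤ returnProb n := by
    rw [← pow_le_pow_iff_left₀ (by positivity) (returnProb_pos n).le two_ne_zero, mul_pow, div_pow,
      hsq, one_pow]
    refine le_trans ?_ (le_returnProb_sq n)
    have : (2 * n / (2 * n + 1) : ℝ) ≤ 1 := by
      rw [div_le_one (by positivity)]
      linarith
    calc 1 / (Real.pi * n) * (2 * n / (2 * n + 1) : ℝ) ^ 2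
        ≤ 1 / (Real.pi * n) * (2 * n / (2 * n + 1)) := by
          gcongr
          exact pow_le_of_le_one (by positivity) this two_ne_zero
      _ = 2 / (Real.pi * (2 * n + 1)) := by field_simp
  have hroot : 1 / √(Real.pi * n) ≤ (n : ℝ) ^ (-(1 / 2) : ℝ) := by
    rw [Real.rpow_neg hn'.le, ← Real.sqrt_eq_rpow, one_div]
    gcongr
    nlinarith [Real.pi_gt_three]
  rw [abs_sub_comm, abs_of_nonneg (by linarith)]
  calc 1 / √(Real.pi * n) - returnProb n
      ≤ 1 / √(Real.pi * n) * (1 / (2 * n + 1)) := by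
        have : 1 - 2 * (n : ℝ) / (2 * n + 1) = 1 / (2 * n + 1) := by field_simp; ring
        rw [← this]
        linarith
    _ ≤ (n : ℝ) ^ (-(1 / 2) : ℝ) * (n : ℝ) ^ (-1 : ℝ) := by
        rw [Real.rpow_neg_one, ← one_div (n : ℝ)]
        gcongr
        linarith
    _ = (n : ℝ) ^ (-(3 / 2) : ℝ) := by
        rw [← Real.rpow_add hn']
        norm_num

/-! ### The sequence `(n + 1) ^ (-3 / 2)` -/

/-- The sequence `(n + 1) ^ (-3 / 2)`. -/
noncomputable def threeHalves (n : ℕ) : ℝ := ((n : ℝ) + 1) ^ (-(3 / 2) : ℝ)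

theorem threeHalves_pos (n : ℕ) : 0 < threeHalves n := by
  unfold threeHalves
  positivity

theorem threeHalves_antitone : Antitone threeHalves := fun m n h => by
  have : (m : ℝ) ≤ n := by exact_mod_cast h
  exact Real.rpow_le_rpow_of_nonpos (by positivity) (by linarith) (by norm_num)

theorem threeHalves_le {n : ℕ} (hn : 0 < n) : threeHalves n ≤ (n : ℝ) ^ (-(3 / 2) : ℝ) :=
  Real.rpow_le_rpow_of_nonpos (by exact_mod_cast hn) (by linarith) (by norm_num)

theorem summable_threeHalves : Summable threeHalves := by
  have h := (summable_nat_add_iff 1).2 (Real.summable_nat_rpow.2 (show -(3 / 2 : ℝ) < -1 by norm_num))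
  refine h.congr fun n => ?_
  simp [threeHalves]

theorem returnProb_div_le (n : ℕ) : returnProb n / (n + 1) ≤ threeHalves n := by
  have hn : (0 : ℝ) < n + 1 := by positivity
  have h : returnProb n ≤ ((n : ℝ) + 1) ^ (-(1 / 2) : ℝ) := by
    rw [Real.rpow_neg hn.le, ← Real.sqrt_eq_rpow, ← Real.sqrt_inv]
    refine Real.le_sqrt_of_sq_le ?_
    rw [← one_div, le_div_iff₀ hn]
    exact returnProb_sq_mul_le n
  calc returnProb n / (n + 1) ≤ ((n : ℝ) + 1) ^ (-(1 / 2) : ℝ) * ((n : ℝ) + 1) ^ (-1 : ℝ) := by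
        rw [Real.rpow_neg_one, div_eq_mul_inv]
        gcongr
    _ = threeHalves n := by
        rw [← Real.rpow_add hn, threeHalves]
        norm_num

/-- Submultiplicativity of `n + 1` turned into an upper bound for an earlier term. -/
theorem threeHalves_sub_mul_le {n j : ℕ} (hj : j ≤ n) :
    threeHalves (n - j) * threeHalves j ≤ threeHalves n := by
  unfold threeHalves
  rw [← Real.mul_rpow (by positivity) (by positivity)]
  refine Real.rpow_le_rpow_of_nonpos (by positivity) ?_ (by norm_num)
  obtain ⟨i, rfl⟩ := Nat.exists_eq_add_of_le hj
  simp only [Nat.add_sub_cancel_left]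
  push_cast
  nlinarith [(Nat.cast_nonneg i : (0 : ℝ) ≤ i), (Nat.cast_nonneg j : (0 : ℝ) ≤ j),
    mul_nonneg (Nat.cast_nonneg (α := ℝ) i) (Nat.cast_nonneg (α := ℝ) j)]

theorem threeHalves_le_of_le_two_mul {m n : ℕ} (h : n ≤ 2 * m) :
    threeHalves m ≤ 4 * threeHalves n := by
  have h' : (n : ℝ) ≤ 2 * m := by exact_mod_cast h
  have h2 : ((2 : ℝ)⁻¹) ^ (-(3 / 2) : ℝ) ≤ 4 := by
    rw [Real.inv_rpow (by norm_num), ← Real.rpow_neg (by norm_num), neg_neg]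
    calc (2 : ℝ) ^ (3 / 2 : ℝ) ≤ 2 ^ (2 : ℝ) :=
          Real.rpow_le_rpow_of_exponent_le (by norm_num) (by norm_num)
      _ = 4 := by norm_num
  calc threeHalves m ≤ ((2 : ℝ)⁻¹ * (n + 1)) ^ (-(3 / 2) : ℝ) :=
        Real.rpow_le_rpow_of_nonpos (by positivity) (by linarith) (by norm_num)
    _ = (2 : ℝ)⁻¹ ^ (-(3 / 2) : ℝ) * threeHalves n := by
        rw [Real.mul_rpow (by norm_num) (by positivity), threeHalves]
    _ ≤ 4 * threeHalves n := by
        gcongr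
        exact (threeHalves_pos n).le

/-- One of j, n-j is at least n/2, so its factor is at most 4 times `threeHalves n`, while the other
is summable. The two halves give 8 = 2 · 4. -/
theorem sum_threeHalves_mul_le (n : ℕ) :
    ∑ j ∈ Finset.range n, threeHalves j * threeHalves (n - j) ≤
      8 * (∑' k, threeHalves k) * threeHalves n := by
  have hpos : ∀ k, 0 ≤ threeHalves k := fun k => (threeHalves_pos k).le
  -- The index n-1-j replaces n-j so that reflection maps `range n` to itself.
  have hterm : ∀ j ∈ Finset.range n, threeHalves j * threeHalves (n - j) ≤
      4 * threeHalves n * (threeHalves j + threeHalves (n - 1 - j)) := by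
    intro j hj
    have hj' := Finset.mem_range.1 hj
    have h0 : threeHalves (n - j) ≤ threeHalves (n - 1 - j) := threeHalves_antitone (by omega)
    rcases le_total n (2 * j) with h | h
    · have h1 := threeHalves_le_of_le_two_mul h
      nlinarith [mul_le_mul h1 h0 (hpos _) (by linarith [hpos n]), mul_nonneg (hpos n) (hpos j)]
    · have h1 := threeHalves_le_of_le_two_mul (show n ≤ 2 * (n - j) by omega)
      nlinarith [mul_le_mul_of_nonneg_left h1 (hpos j), mul_nonneg (hpos n) (hpos (n - 1 - j))]
  have hsum : ∑ j ∈ Finset.range n, threeHalves j ≤ ∑' k, threeHalves k :=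
    summable_threeHalves.sum_le_tsum _ fun k _ => hpos k
  calc _ ≤ _ := Finset.sum_le_sum hterm
    _ = 4 * threeHalves n * (2 * ∑ j ∈ Finset.range n, threeHalves j) := by
        rw [← Finset.mul_sum, Finset.sum_add_distrib, Finset.sum_range_reflect threeHalves n,
          two_mul]
    _ ≤ 4 * threeHalves n * (2 * ∑' k, threeHalves k) := by
        have := hpos n
        gcongr
    _ = _ := by ring

/-! ### The first-passage distribution -/

theorem passageProb_eq (p : ℝ) (k : ℕ) :
    passageProb p k = p * (4 * p * (1 - p)) ^ k * (returnProb k / (k + 1)) := by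
  rw [passageProb, ← catalan_div_four_pow, show 4 * p * (1 - p) = 4 * (p * (1 - p)) by ring,
    mul_pow 4]
  field_simp

theorem four_mul_nonneg {p : ℝ} (h0 : 0 ≤ p) (h1 : p ≤ 1) : 0 ≤ 4 * p * (1 - p) :=
  mul_nonneg (by linarith) (by linarith)

theorem four_mul_le_one (p : ℝ) : 4 * p * (1 - p) ≤ 1 := by
  nlinarith [sq_nonneg (2 * p - 1)]

theorem four_mul_lt_one {p : ℝ} (hp : p ≠ 1 / 2) : 4 * p * (1 - p) < 1 := by
  have : 0 < (p - 1 / 2) ^ 2 := by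
    have := sub_ne_zero.2 hp
    positivity
  nlinarith

theorem passageProb_nonneg {p : ℝ} (h0 : 0 ≤ p) (h1 : p ≤ 1) (k : ℕ) : 0 ≤ passageProb p k := by
  rw [passageProb_eq]
  have := four_mul_nonneg h0 h1
  have := returnProb_pos k
  positivity

theorem passageProb_le {p : ℝ} (h0 : 0 ≤ p) (h1 : p ≤ 1) (k : ℕ) :
    passageProb p k ≤ (4 * p * (1 - p)) ^ k * threeHalves k := by
  rw [passageProb_eq]
  have := pow_nonneg (four_mul_nonneg h0 h1) k
  have h2 := returnProb_div_le k
  have := (threeHalves_pos k).le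
  have := returnProb_pos k
  calc p * (4 * p * (1 - p)) ^ k * (returnProb k / (k + 1))
      ≤ 1 * (4 * p * (1 - p)) ^ k * threeHalves k := by gcongr
    _ = _ := by ring

theorem passageProb_le_threeHalves {p : ℝ} (h0 : 0 ≤ p) (h1 : p ≤ 1) (k : ℕ) :
    passageProb p k ≤ threeHalves k :=
  (passageProb_le h0 h1 k).trans (mul_le_of_le_one_left (threeHalves_pos k).le
    (pow_le_one₀ (four_mul_nonneg h0 h1) (four_mul_le_one p)))

theorem summable_passageProb {p : ℝ} (h0 : 0 ≤ p) (h1 : p ≤ 1) : Summable (passageProb p) :=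
  summable_threeHalves.of_nonneg_of_le (passageProb_nonneg h0 h1)
    (passageProb_le_threeHalves h0 h1)

theorem passageProb_zero (p : ℝ) : passageProb p 0 = p := by simp [passageProb]

/-- A passage after time 1 begins with an up step, followed by two successive one-level passages. -/
theorem passageProb_succ (p : ℝ) (n : ℕ) :
    passageProb p (n + 1) =
      (1 - p) * ∑ x ∈ Finset.HasAntidiagonal.antidiagonal n, passageProb p x.1 * passageProb p x.2 := by
  rw [passageProb, catalan_succ']
  push_cast
  simp only [Finset.mul_sum]
  refine Finset.sum_congr rfl fun x hx => ?_
  rw [Finset.HasAntidiagonal.mem_antidiagonal] at hx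
  rw [passageProb, passageProb, ← hx, pow_succ, pow_add]
  ring

theorem mul_sum_range_passageProb_mul (p : ℝ) (n : ℕ) :
    (1 - p) * ∑ j ∈ Finset.range n,
        passageProb p j * ∑ k ∈ Finset.range (n - j), passageProb p k =
      ∑ k ∈ Finset.range (n + 1), passageProb p k - p := by
  simp only [Finset.mul_sum (Finset.range (n - _))]
  rw [← Finset.sum_range_diag_flip n fun j k => passageProb p j * passageProb p k,
    Finset.sum_range_succ', passageProb_zero, add_sub_cancel_right, Finset.mul_sum]
  refine Finset.sum_congr rfl fun k _ => ?_
  rw [passageProb_succ, Finset.Nat.sum_antidiagonal_eq_sum_range_succ_mk]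

/-- By the recurrence, the next partial sum is at most p + (1-p)S² for the current sum S, so no
nonnegative fixed point y is ever crossed. Hence the total mass is the smaller of the roots 1 and
p/(1-p). -/
theorem sum_range_passageProb_le {p y : ℝ} (h0 : 0 ≤ p) (h1 : p ≤ 1) (hy : 0 ≤ y)
    (hfix : p + (1 - p) * y ^ 2 = y) (n : ℕ) : ∑ k ∈ Finset.range n, passageProb p k ≤ y := by
  have hf := passageProb_nonneg h0 h1
  induction n with
  | zero => simpa using hy
  | succ n ih =>
    have h := mul_sum_range_passageProb_mul p n
    have hle : ∑ j ∈ Finset.range n, passageProb p j * ∑ k ∈ Finset.range (n - j), passageProb p k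
        ≤ y ^ 2 := by
      calc _ ≤ ∑ j ∈ Finset.range n, passageProb p j * y := by
            refine Finset.sum_le_sum fun j _ => mul_le_mul_of_nonneg_left (le_trans ?_ ih) (hf j)
            exact Finset.sum_le_sum_of_subset_of_nonneg
              (Finset.range_subset_range.2 (Nat.sub_le n j)) fun k _ _ => hf k
        _ = (∑ j ∈ Finset.range n, passageProb p j) * y := by rw [Finset.sum_mul]
        _ ≤ y ^ 2 := by
            rw [sq]
            gcongr
    nlinarith [mul_le_mul_of_nonneg_left hle (sub_nonneg.2 h1)]

theorem tsum_passageProb_fixed {p : ℝ} (h0 : 0 ≤ p) (h1 : p ≤ 1) :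
    p + (1 - p) * (∑' k, passageProb p k) ^ 2 = ∑' k, passageProb p k := by
  have hs := summable_passageProb h0 h1
  have hn : Summable fun k => ‖passageProb p k‖ := hs.norm
  rw [sq, tsum_mul_tsum_eq_tsum_sum_antidiagonal_of_summable_norm hn hn, ← tsum_mul_left]
  simp only [← passageProb_succ]
  rw [hs.tsum_eq_zero_add, passageProb_zero]

theorem tsum_passageProb_le {p y : ℝ} (h0 : 0 ≤ p) (h1 : p ≤ 1) (hy : 0 ≤ y)
    (hfix : p + (1 - p) * y ^ 2 = y) : ∑' k, passageProb p k ≤ y :=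
  Real.tsum_le_of_sum_range_le (passageProb_nonneg h0 h1) (sum_range_passageProb_le h0 h1 hy hfix)

theorem tsum_passageProb_eq_or {p : ℝ} (h0 : 0 ≤ p) (h1 : p < 1) :
    ∑' k, passageProb p k = 1 ∨ ∑' k, passageProb p k = p / (1 - p) := by
  have h := tsum_passageProb_fixed h0 h1.le
  have hq : 0 < 1 - p := by linarith
  set F := ∑' k, passageProb p k
  have : (F - 1) * ((1 - p) * F - p) = 0 := by linear_combination h
  rcases mul_eq_zero.1 this with h2 | h2
  · exact Or.inl (by linarith)
  · refine Or.inr ?_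
    rw [eq_div_iff hq.ne']
    linarith

theorem tsum_passageProb_of_half_le {p : ℝ} (h0 : 1 / 2 ≤ p) (h1 : p < 1) :
    ∑' k, passageProb p k = 1 := by
  have hle := tsum_passageProb_le (p := p) (y := 1) (by linarith) h1.le zero_le_one (by ring)
  refine (tsum_passageProb_eq_or (by linarith) h1).elim id fun h => le_antisymm hle ?_
  rw [h, one_le_div (by linarith)]
  linarith

theorem tsum_passageProb_of_le_half {p : ℝ} (h0 : 0 ≤ p) (h1 : p ≤ 1 / 2) :
    ∑' k, passageProb p k = p / (1 - p) := by
  have hq : 0 < 1 - p := by linarith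
  have hle := tsum_passageProb_le (p := p) (y := p / (1 - p)) h0 (by linarith) (by positivity)
    (by field_simp; ring)
  refine (tsum_passageProb_eq_or h0 (by linarith)).elim (fun h => le_antisymm hle ?_) id
  rw [h, div_le_one hq]
  linarith

/-- The probability that the first passage happens at time `2 * n + 1` or later. -/
noncomputable def passageTail (p : ℝ) (n : ℕ) : ℝ := ∑' k, passageProb p (k + n)

theorem sum_range_passageProb {p : ℝ} (h0 : 0 ≤ p) (h1 : p ≤ 1) (n : ℕ) :
    ∑ k ∈ Finset.range n, passageProb p k = ∑' k, passageProb p k - passageTail p n :=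
  eq_sub_of_add_eq ((summable_passageProb h0 h1).sum_add_tsum_nat_add n)

theorem passageTail_nonneg {p : ℝ} (h0 : 0 ≤ p) (h1 : p ≤ 1) (n : ℕ) : 0 ≤ passageTail p n :=
  tsum_nonneg fun _ => passageProb_nonneg h0 h1 _

theorem passageTail_le {p : ℝ} (h0 : 0 ≤ p) (h1 : p ≤ 1) (hp : p ≠ 1 / 2) (n : ℕ) :
    passageTail p n ≤ (1 - 4 * p * (1 - p))⁻¹ * ((4 * p * (1 - p)) ^ n * threeHalves n) := by
  have hx0 := four_mul_nonneg h0 h1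
  have hx1 := four_mul_lt_one hp
  rw [← tsum_geometric_of_lt_one hx0 hx1, ← tsum_mul_right]
  refine Summable.tsum_le_tsum (fun k => ?_)
    ((summable_nat_add_iff n).2 (summable_passageProb h0 h1))
    ((summable_geometric_of_lt_one hx0 hx1).mul_right _)
  refine (passageProb_le h0 h1 (k + n)).trans ?_
  rw [pow_add, mul_assoc]
  have := threeHalves_antitone (show n ≤ k + n by omega)
  gcongr

/-- The N-excursion probability in terms of the two first-passage distributions. -/
theorem dyckNExcursionProb_eq_tail {pm p1 pb : ℝ} (hpm : 0 < pm) (hp1 : 0 < p1) (hpb : 0 ≤ pb)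
    (hsum : pm + p1 + pb = 1) (n : ℕ) :
    dyckNExcursionProb pm p1 pb (2 * n) =
      (1 - ∑' k, passageProb pm k) * (1 - ∑' k, passageProb p1 k)
        + (1 - ∑' k, passageProb pm k) * passageTail p1 n + passageTail pm n
        - ∑ j ∈ Finset.range n, passageProb p1 j * passageTail pm (n - j) := by
  have hm := sum_range_passageProb hpm.le (by linarith : pm ≤ 1)
  have h1 := sum_range_passageProb hp1.le (by linarith : p1 ≤ 1)
  rw [dyckNExcursionProb_eq hsum]
  simp only [hm, mul_sub, Finset.sum_sub_distrib, ← Finset.sum_mul, h1]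
  ring

/-! ### Asymptotics -/

/-- Bounds are kept in the shifted weight, valid at n = 0 too, and converted to n^(-3/2) only here.
-/
theorem isBigO_of_le_threeHalves {f g : ℕ → ℝ} {C : ℝ} (hg : ∀ n, 0 ≤ g n)
    (h : ∀ n, |f n| ≤ C * (g n * threeHalves n)) :
    f =O[atTop] fun n : ℕ => g n / (n : ℝ) ^ (3 / 2 : ℝ) := by
  refine IsBigO.of_bound |C| ?_
  filter_upwards [eventually_gt_atTop 0] with n hn
  have h1 := threeHalves_le hn
  rw [Real.rpow_neg (Nat.cast_nonneg n)] at h1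
  have h2 : 0 ≤ g n * threeHalves n := mul_nonneg (hg n) (threeHalves_pos n).le
  have h3 : 0 ≤ g n / (n : ℝ) ^ (3 / 2 : ℝ) := div_nonneg (hg n) (by positivity)
  rw [Real.norm_eq_abs, Real.norm_eq_abs, abs_of_nonneg h3]
  refine (h n).trans (mul_le_mul (le_abs_self C) ?_ h2 (abs_nonneg C))
  rw [div_eq_mul_inv]
  exact mul_le_mul_of_nonneg_left h1 (hg n)

/-- Raising the smaller rate to the larger one makes the exponentials combine to x^j x^(n-j) = x^n,
leaving a convolution of `threeHalves`. -/
theorem sum_passageProb_mul_passageTail_le {p q : ℝ} (hp0 : 0 ≤ p) (hp1 : p ≤ 1)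
    (hp : p ≠ 1 / 2) (hq0 : 0 ≤ q) (hq1 : q ≤ 1)
    (hqp : 4 * q * (1 - q) ≤ 4 * p * (1 - p)) (n : ℕ) :
    ∑ j ∈ Finset.range n, passageProb q j * passageTail p (n - j) ≤
      (1 - 4 * p * (1 - p))⁻¹ * (8 * ∑' k, threeHalves k) *
        ((4 * p * (1 - p)) ^ n * threeHalves n) := by
  set x := 4 * p * (1 - p) with hx
  have hx0 : 0 ≤ x := four_mul_nonneg hp0 hp1
  have hx1 : 0 < 1 - x := sub_pos.2 (four_mul_lt_one hp)
  have hy0 := four_mul_nonneg hq0 hq1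
  calc _ ≤ ∑ j ∈ Finset.range n, (1 - x)⁻¹ * x ^ n * (threeHalves j * threeHalves (n - j)) := by
        refine Finset.sum_le_sum fun j hj => ?_
        have hj' := (Finset.mem_range.1 hj).le
        have h1 : passageProb q j ≤ x ^ j * threeHalves j :=
          (passageProb_le hq0 hq1 j).trans (by
            have := (threeHalves_pos j).le
            gcongr)
        have h2 := passageTail_le hp0 hp1 hp (n - j)
        have h3 := (threeHalves_pos j).le
        refine (mul_le_mul h1 h2 (passageTail_nonneg hp0 hp1 _) (by positivity)).trans (le_of_eq ?_)
        rw [← hx, ← pow_mul_pow_sub x hj']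
        ring
    _ = (1 - x)⁻¹ * x ^ n * ∑ j ∈ Finset.range n, threeHalves j * threeHalves (n - j) := by
        rw [Finset.mul_sum]
    _ ≤ (1 - x)⁻¹ * x ^ n * (8 * (∑' k, threeHalves k) * threeHalves n) := by
        have := sum_threeHalves_mul_le n
        gcongr
    _ = _ := by ring

/-- The exponential error term away from the critical point `pm = 1 / 2`. -/
theorem dyckNExcursionProb_sub_isBigO {pm p1 pb : ℝ} (hpm : 0 < pm) (hp1 : 0 < p1) (hpb : 0 ≤ pb)
    (hsum : pm + p1 + pb = 1) (hle : p1 ≤ pm) (hhalf : pm ≠ 1 / 2) (hhalf' : p1 ≠ 1 / 2) :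
    (fun n : ℕ => dyckNExcursionProb pm p1 pb (2 * n) -
        (1 - ∑' k, passageProb pm k) * (1 - ∑' k, passageProb p1 k))
      =O[atTop] fun n : ℕ => (4 * pm * (1 - pm)) ^ n / (n : ℝ) ^ (3 / 2 : ℝ) := by
  have hm1 : pm ≤ 1 := by linarith
  have h11 : p1 ≤ 1 := by linarith
  have hx0 := four_mul_nonneg hpm.le hm1
  -- The difference is 4(pm - p1)(1 - pm - p1), so `pm` has the dominant rate even beyond 1/2.
  have hqp : 4 * p1 * (1 - p1) ≤ 4 * pm * (1 - pm) := by
    nlinarith [mul_nonneg (sub_nonneg.2 hle) (show 0 ≤ 1 - pm - p1 by linarith)]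
  set A := 1 - ∑' k, passageProb pm k with hA
  refine isBigO_of_le_threeHalves (C := |A| * (1 - 4 * p1 * (1 - p1))⁻¹ +
    (1 - 4 * pm * (1 - pm))⁻¹ + (1 - 4 * pm * (1 - pm))⁻¹ * (8 * ∑' k, threeHalves k))
    (fun n => pow_nonneg hx0 n) fun n => ?_
  have hS := passageTail_le hp1.le h11 hhalf' n
  have hS' : passageTail p1 n ≤
      (1 - 4 * p1 * (1 - p1))⁻¹ * ((4 * pm * (1 - pm)) ^ n * threeHalves n) := by
    refine hS.trans ?_
    have := (threeHalves_pos n).le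
    have := four_mul_nonneg hp1.le h11
    have := (sub_pos.2 (four_mul_lt_one hhalf')).le
    gcongr
  have hT := passageTail_le hpm.le hm1 hhalf n
  have hV := sum_passageProb_mul_passageTail_le hpm.le hm1 hhalf hp1.le h11 hqp n
  have hV0 : 0 ≤ ∑ j ∈ Finset.range n, passageProb p1 j * passageTail pm (n - j) :=
    Finset.sum_nonneg fun j _ =>
      mul_nonneg (passageProb_nonneg hp1.le h11 j) (passageTail_nonneg hpm.le hm1 _)
  rw [dyckNExcursionProb_eq_tail hpm hp1 hpb hsum, ← hA]
  have hAS : |A * passageTail p1 n| ≤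
      |A| * ((1 - 4 * p1 * (1 - p1))⁻¹ * ((4 * pm * (1 - pm)) ^ n * threeHalves n)) := by
    rw [abs_mul, abs_of_nonneg (passageTail_nonneg hp1.le h11 n)]
    gcongr
  have hT0 := passageTail_nonneg hpm.le hm1 n
  rw [abs_le] at hAS ⊢
  constructor <;> linarith [hAS.1, hAS.2]

/-! ### The critical value 1/2 -/

theorem passageProb_half (k : ℕ) : passageProb (1 / 2) k = returnProb k / (2 * (k + 1)) := by
  rw [passageProb_eq, show (4 : ℝ) * (1 / 2) * (1 - 1 / 2) = 1 by norm_num, one_pow]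
  field_simp

/-- The sum telescopes: each term is `returnProb k - returnProb (k + 1)`. -/
theorem sum_range_passageProb_half (n : ℕ) :
    ∑ k ∈ Finset.range n, passageProb (1 / 2) k = 1 - returnProb n := by
  induction n with
  | zero => simp [returnProb]
  | succ n ih =>
    rw [Finset.sum_range_succ, ih, passageProb_half, returnProb_succ]
    field_simp
    ring

theorem passageTail_half (n : ℕ) : passageTail (1 / 2) n = returnProb n := by
  have h := sum_range_passageProb (p := 1 / 2) (by norm_num) (by norm_num) n
  rw [sum_range_passageProb_half, tsum_passageProb_of_half_le le_rfl (by norm_num)] at h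
  linarith

theorem returnProb_sub_le {n j : ℕ} (hj : j ≤ n) :
    returnProb (n - j) - returnProb n ≤ j * threeHalves (n - j) := by
  have h : returnProb (n - j) - returnProb n =
      ∑ k ∈ Finset.Ico (n - j) n, passageProb (1 / 2) k := by
    rw [Finset.sum_Ico_eq_sub _ (Nat.sub_le n j), sum_range_passageProb_half,
      sum_range_passageProb_half]
    ring
  rw [h]
  refine (Finset.sum_le_card_nsmul _ _ (threeHalves (n - j)) fun k hk => ?_).trans (le_of_eq ?_)
  · exact (passageProb_le_threeHalves (by norm_num) (by norm_num) k).trans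
      (threeHalves_antitone (Finset.mem_Ico.1 hk).1)
  · rw [Nat.card_Ico, nsmul_eq_mul, Nat.sub_sub_self hj]

theorem returnProb_le_sub {n j : ℕ} : returnProb n ≤ returnProb (n - j) := by
  rw [← passageTail_half, ← passageTail_half]
  have h1 := sum_range_passageProb (p := 1 / 2) (by norm_num) (by norm_num) n
  have h2 := sum_range_passageProb (p := 1 / 2) (by norm_num) (by norm_num) (n - j)
  have h3 := Finset.sum_le_sum_of_subset_of_nonneg (f := passageProb (1 / 2))
    (Finset.range_subset_range.2 (Nat.sub_le n j)) fun k _ _ =>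
      passageProb_nonneg (by norm_num) (by norm_num) k
  linarith

/-- The increment costs a factor j, which the geometric decay away from 1/2 absorbs. -/
theorem sum_passageProb_mul_returnProb_sub_le {q : ℝ} (hq0 : 0 ≤ q) (hq1 : q ≤ 1)
    (hq : q ≠ 1 / 2) (n : ℕ) :
    ∑ j ∈ Finset.range n, passageProb q j * (returnProb (n - j) - returnProb n) ≤
      (∑' j : ℕ, (j : ℝ) * (4 * q * (1 - q)) ^ j) * threeHalves n := by
  have hy0 := four_mul_nonneg hq0 hq1
  have hy1 := four_mul_lt_one hq
  have hs : Summable fun j : ℕ => (j : ℝ) * (4 * q * (1 - q)) ^ j := by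
    simpa using summable_pow_mul_geometric_of_norm_lt_one 1
      (r := 4 * q * (1 - q)) (by rwa [Real.norm_eq_abs, abs_of_nonneg hy0])
  have hn := (threeHalves_pos n).le
  calc _ ≤ ∑ j ∈ Finset.range n, (j : ℝ) * (4 * q * (1 - q)) ^ j * threeHalves n := by
        refine Finset.sum_le_sum fun j hj => ?_
        have hj' := (Finset.mem_range.1 hj).le
        have h1 := passageProb_le hq0 hq1 j
        have h2 := returnProb_sub_le hj'
        have h3 := threeHalves_sub_mul_le hj'
        have h4 := (threeHalves_pos j).le
        calc passageProb q j * (returnProb (n - j) - returnProb n)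
            ≤ (4 * q * (1 - q)) ^ j * threeHalves j * (j * threeHalves (n - j)) :=
              mul_le_mul h1 h2 (sub_nonneg.2 returnProb_le_sub) (by positivity)
          _ = j * (4 * q * (1 - q)) ^ j * (threeHalves (n - j) * threeHalves j) := by ring
          _ ≤ _ := by gcongr
    _ = (∑ j ∈ Finset.range n, (j : ℝ) * (4 * q * (1 - q)) ^ j) * threeHalves n := by
        rw [Finset.sum_mul]
    _ ≤ _ := by
        gcongr
        exact hs.sum_le_tsum _ fun j _ => by positivity

theorem dyckNExcursionProb_half_sub_isBigO {p1 pb : ℝ} (hp1 : 0 < p1) (hpb : 0 ≤ pb)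
    (hsum : 1 / 2 + p1 + pb = 1) (hhalf : p1 ≠ 1 / 2) :
    (fun n : ℕ => dyckNExcursionProb (1 / 2) p1 pb (2 * n) -
        (1 - ∑' k, passageProb p1 k) * returnProb n)
      =O[atTop] fun n : ℕ => 1 / (n : ℝ) ^ (3 / 2 : ℝ) := by
  have h11 : p1 ≤ 1 := by linarith
  have hy0 := four_mul_nonneg hp1.le h11
  refine isBigO_of_le_threeHalves (g := fun _ => 1) (C := (1 - 4 * p1 * (1 - p1))⁻¹ +
    ∑' j : ℕ, (j : ℝ) * (4 * p1 * (1 - p1)) ^ j) (fun _ => zero_le_one) fun n => ?_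
  -- The mass of `1/2` is 1, so the constant term vanishes; centring the convolution at `returnProb
  -- n` isolates the main term.
  have hformula : dyckNExcursionProb (1 / 2) p1 pb (2 * n) -
      (1 - ∑' k, passageProb p1 k) * returnProb n = returnProb n * passageTail p1 n -
        ∑ j ∈ Finset.range n, passageProb p1 j * (returnProb (n - j) - returnProb n) := by
    rw [dyckNExcursionProb_eq_tail (by norm_num) hp1 hpb hsum,
      tsum_passageProb_of_half_le le_rfl (by norm_num)]
    simp only [passageTail_half, mul_sub, Finset.sum_sub_distrib, ← Finset.sum_mul,
      sum_range_passageProb hp1.le h11]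
    ring
  have hS0 := passageTail_nonneg hp1.le h11 n
  have hS : returnProb n * passageTail p1 n ≤ (1 - 4 * p1 * (1 - p1))⁻¹ * threeHalves n := by
    have hn := (threeHalves_pos n).le
    have hinv := (sub_pos.2 (four_mul_lt_one hhalf)).le
    calc _ ≤ 1 * passageTail p1 n := by
          gcongr
          exact returnProb_le_one n
      _ ≤ (1 - 4 * p1 * (1 - p1))⁻¹ * ((4 * p1 * (1 - p1)) ^ n * threeHalves n) := by
          rw [one_mul]
          exact passageTail_le hp1.le h11 hhalf n
      _ ≤ (1 - 4 * p1 * (1 - p1))⁻¹ * (1 * threeHalves n) := by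
          gcongr
          exact pow_le_one₀ hy0 (four_mul_le_one p1)
      _ = _ := by rw [one_mul]
  have hS1 : 0 ≤ returnProb n * passageTail p1 n := mul_nonneg (returnProb_pos n).le hS0
  have hV := sum_passageProb_mul_returnProb_sub_le hp1.le h11 hhalf n
  have hV0 : 0 ≤ ∑ j ∈ Finset.range n, passageProb p1 j * (returnProb (n - j) - returnProb n) :=
    Finset.sum_nonneg fun j _ =>
      mul_nonneg (passageProb_nonneg hp1.le h11 j) (sub_nonneg.2 returnProb_le_sub)
  rw [hformula, abs_le]
  constructor <;> linarith

theorem returnProb_sub_isBigO :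
    (fun n : ℕ => returnProb n - 1 / √(Real.pi * (n : ℝ)))
      =O[atTop] fun n : ℕ => 1 / (n : ℝ) ^ (3 / 2 : ℝ) := by
  refine IsBigO.of_bound 1 ?_
  filter_upwards [eventually_gt_atTop 0] with n hn
  rw [one_mul, Real.norm_eq_abs, Real.norm_of_nonneg (by positivity),
    one_div ((n : ℝ) ^ (3 / 2 : ℝ)), ← Real.rpow_neg (Nat.cast_nonneg n)]
  exact abs_returnProb_sub_le hn

/-- The convolution is evaluated by the first-passage recurrence, leaving 2(r_n - r_(n+1)) with r =
`returnProb`. -/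
theorem dyckNExcursionProb_half_half (n : ℕ) :
    dyckNExcursionProb (1 / 2) (1 / 2) 0 (2 * n) = returnProb n / (n + 1) := by
  have h := mul_sum_range_passageProb_mul (1 / 2) n
  rw [sum_range_passageProb_half, returnProb_succ] at h
  rw [dyckNExcursionProb_eq (by norm_num), sum_range_passageProb_half]
  have h2 : returnProb n / (n + 1) =
      2 * returnProb n - 2 * (returnProb n * ((2 * n + 1) / (2 * n + 2))) := by
    field_simp
    ring
  rw [h2]
  linarith

theorem returnProb_div_sub_isBigO :
    (fun n : ℕ => returnProb n / (n + 1) - 1 / √(Real.pi * (n : ℝ) ^ 3))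
      =O[atTop] fun n : ℕ => 1 / (n : ℝ) ^ (5 / 2 : ℝ) := by
  refine IsBigO.of_bound 2 ?_
  filter_upwards [eventually_gt_atTop 0] with n hn
  have hn' : (0 : ℝ) < n := by exact_mod_cast hn
  have hpi := Real.pi_pos
  rw [Real.norm_eq_abs, Real.norm_of_nonneg (by positivity), one_div ((n : ℝ) ^ (5 / 2 : ℝ)),
    ← Real.rpow_neg hn'.le]
  have hsplit : (n : ℝ) ^ (-(5 / 2) : ℝ) = (n : ℝ) ^ (-(3 / 2) : ℝ) * (1 / n) := by
    rw [one_div, ← Real.rpow_neg_one, ← Real.rpow_add hn']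
    norm_num
  have hroot : √(Real.pi * (n : ℝ) ^ 3) = √(Real.pi * n) * n := by
    rw [show Real.pi * (n : ℝ) ^ 3 = Real.pi * n * n ^ 2 by ring, Real.sqrt_mul (by positivity),
      Real.sqrt_sq hn'.le]
  have hs : 0 < √(Real.pi * n) := by positivity
  have hle : 1 / √(Real.pi * n) * (1 / n) ≤ (n : ℝ) ^ (-(3 / 2) : ℝ) := by
    calc 1 / √(Real.pi * n) * (1 / n) ≤ (n : ℝ) ^ (-(1 / 2) : ℝ) * (n : ℝ) ^ (-1 : ℝ) := by
          rw [Real.rpow_neg_one, one_div (n : ℝ), Real.rpow_neg hn'.le, ← Real.sqrt_eq_rpow,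
            one_div]
          gcongr
          nlinarith [Real.pi_gt_three]
      _ = _ := by
          rw [← Real.rpow_add hn']
          norm_num
  -- One error comes from `returnProb n`, the other from replacing 1/n by 1/(n+1). Each is at most
  -- n^(-5/2), whence the constant 2.
  have hdecomp : returnProb n / (n + 1) - 1 / √(Real.pi * (n : ℝ) ^ 3) =
      (returnProb n - 1 / √(Real.pi * n)) * (1 / (n + 1)) -
        1 / √(Real.pi * n) * (1 / n) * (1 / (n + 1)) := by
    rw [hroot]
    field_simp
    ring
  have hinv : 1 / ((n : ℝ) + 1) ≤ 1 / n := one_div_le_one_div_of_le hn' (by linarith)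
  have h0 : 0 ≤ (n : ℝ) ^ (-(3 / 2) : ℝ) := by positivity
  rw [hdecomp, hsplit]
  refine (abs_sub _ _).trans ?_
  rw [abs_mul, abs_of_pos (show 0 < 1 / ((n : ℝ) + 1) by positivity),
    abs_of_pos (show 0 < 1 / √(Real.pi * n) * (1 / n) * (1 / ((n : ℝ) + 1)) by positivity)]
  have h1 := mul_le_mul (abs_returnProb_sub_le hn) hinv (by positivity) h0
  have h2 := mul_le_mul hle hinv (by positivity) h0
  linarith

theorem mainTheorem4 (pm p1 pb : ℝ) (hpm : 0 < pm) (hp1 : 0 < p1) (hpb : 0 ≤ pb)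
    (hsum : pm + p1 + pb = 1) :
    (∀ n : ℕ, dyckNExcursionProb pm p1 pb (2 * n) = dyckNExcursionProb p1 pm pb (2 * n)) ∧
    (p1 ≤ pm → pm < 1 / 2 →
      (fun n : ℕ => dyckNExcursionProb pm p1 pb (2 * n)
          - (1 - 2 * p1) * (1 - 2 * pm) / ((1 - p1) * (1 - pm)))
        =O[atTop] fun n : ℕ => (4 * pm * (1 - pm)) ^ n / (n : ℝ) ^ (3 / 2 : ℝ)) ∧
    (p1 < 1 / 2 → pm = 1 / 2 →
      (fun n : ℕ => dyckNExcursionProb pm p1 pb (2 * n)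
          - (1 - 2 * p1) / ((1 - p1) * √(Real.pi * (n : ℝ))))
        =O[atTop] fun n : ℕ => 1 / (n : ℝ) ^ (3 / 2 : ℝ)) ∧
    (p1 = 1 / 2 → pm = 1 / 2 →
      (fun n : ℕ => dyckNExcursionProb pm p1 pb (2 * n) - 1 / √(Real.pi * (n : ℝ) ^ 3))
        =O[atTop] fun n : ℕ => 1 / (n : ℝ) ^ (5 / 2 : ℝ)) ∧
    (p1 < 1 / 2 → 1 / 2 < pm →
      (fun n : ℕ => dyckNExcursionProb pm p1 pb (2 * n))
        =O[atTop] fun n : ℕ => (4 * pm * (1 - pm)) ^ n / (n : ℝ) ^ (3 / 2 : ℝ)) := by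
  refine ⟨dyckNExcursionProb_comm hsum, fun hle hlt => ?_, fun hlt heq => ?_, fun h1 hm => ?_,
    fun hlt hgt => ?_⟩
  · have h := dyckNExcursionProb_sub_isBigO hpm hp1 hpb hsum hle hlt.ne (hle.trans_lt hlt).ne
    rw [tsum_passageProb_of_le_half hpm.le hlt.le,
      tsum_passageProb_of_le_half hp1.le (hle.trans hlt.le)] at h
    have hqm : 1 - pm ≠ 0 := by linarith
    have hq1 : 1 - p1 ≠ 0 := by linarith
    rwa [show (1 - pm / (1 - pm)) * (1 - p1 / (1 - p1)) =
      (1 - 2 * p1) * (1 - 2 * pm) / ((1 - p1) * (1 - pm)) by field_simp; ring] at h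
  · subst heq
    have h := (dyckNExcursionProb_half_sub_isBigO hp1 hpb hsum hlt.ne).add
      (returnProb_sub_isBigO.const_mul_left (1 - ∑' k, passageProb p1 k))
    refine h.congr_left fun n => ?_
    have hq1 : 1 - p1 ≠ 0 := by linarith
    rw [← div_div, div_eq_mul_one_div _ √_,
      show (1 - 2 * p1) / (1 - p1) = 1 - ∑' k, passageProb p1 k by
        rw [tsum_passageProb_of_le_half hp1.le hlt.le]
        field_simp
        ring]
    ring
  · obtain rfl : pb = 0 := by linarith
    subst h1 hm
    simpa only [dyckNExcursionProb_half_half] using returnProb_div_sub_isBigO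
  -- For `pm > 1/2` the passage is certain, so the limiting constant is 0.
  · have h := dyckNExcursionProb_sub_isBigO hpm hp1 hpb hsum (hlt.trans hgt).le hgt.ne' hlt.ne
    simpa [tsum_passageProb_of_half_le hgt.le (show pm < 1 by linarith)] using h
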